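/- Let $w:\mathbb N_0\to(0,\infty)$ be non-decreasing and let $f^{\pm}:\mathbb Z\times\mathbb N_0\to(0,\infty)$. Let $\xi=(\xi^{\pm}_k(y))_{y\in\mathbb Z,k\ge 0}$ be independent exponential random variables, $\xi^\pm_k(y)$ having mean $f^\pm(y,k)$, and let the walk $\widetilde X$ on $\mathbb Z$ be built from $\xi$ as follows. It starts at $0$ at time $\tau_0=0$, where clocks of durations $\xi^-_0(0)/w(0)$ and $\xi^+_0(0)/w(0)$ are attached to the oriented edges $(0,-1)$ and $(0,1)$. When one of the two clocks at the present site rings, the walker instantaneously crosses the corresponding edge and both clocks are stopped (if both ring simultaneously, the walker stays there forever). When the walker jumps from $y-1$ to $y$, a new clock of duration $\xi^-_k(y)/w(n)$ is started for $(y,y-1)$, where $k$ is the number of previous jumps from $y$ to $y-1$ and $n$ the number of jumps into $y-1$ so far; the clock of $(y,y+1)$ is restarted where it was stopped if $y$ has been occupied before, and otherwise a new clock of duration $\xi^+_0(y)/w(0)$ is started for $(y,y+1)$. The rule for jumps from $y+1$ to $y$ is symmetric. Let $\tau_k$ be the time of the $k$-th jump, $\widetilde Z_{\tau_k}(y)$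 the number of jumps into $y$ up to time $\tau_k$, $\widetilde Z_\infty(y)=\lim_k\widetilde Z_{\tau_k}(y)$, $\widetilde N_{\tau_k}(y,y\pm1)$ the number of jumps from $y$ to $y\pm1$ up to time $\tau_k$, and $$T_y^\pm:=\sum_{k\ge0}\mathbf 1_{\{\widetilde X_{\tau_k}=y,\ \widetilde X_{\tau_{k+1}}=y\pm1\}}\ \frac{\xi^{\pm}_{\widetilde N_{\tau_k}(y,y\pm1)}(y)}{w(\widetilde Z_{\tau_k}(y\pm1))}\in[0,\infty]$$ (the sum runs over the jumps that occur). Then, for every $y\in\mathbb Z$, $$\mathbb P\left(T_y^+=T_y^-<\infty,\ \widetilde Z_\infty(y-1)=\widetilde Z_\infty(y+1)=\infty\right)=0.$$ In particular this holds, for all $\alpha\ge0$ and $\beta>0$, for $$f^\pm(y,n)=\exp\left(2\beta\left[2(1+\alpha)n-\alpha\mathbf 1_{\{y\pm1=0\}}+(1+\alpha)\mathbf 1_{\{\pm y<0\}}\right]\right),\qquad w(n)=\exp(4\beta\alpha n).$$ -/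

import Mathlib

open MeasureTheory ProbabilityTheory
open scoped ENNReal

/-- The two directions of a nearest-neighbour jump on `ℤ`. -/
inductive Side
  | left
  | right
  deriving DecidableEq

namespace Side

/-- The displacement `-1` or `+1` of a jump. -/
def sgn : Side → ℤ
  | left => -1
  | right => 1

/-- The opposite direction. -/
def opp : Side → Side
  | left => right
  | right => left

end Side

/-- A configuration of the time-line construction right after a jump (or at time `0`). -/
structure RubinState where
  /-- current time -/
  time : ℝ
  /-- current position of the walker -/
  pos : ℤ
  /-- number of visits to each site so far (jumps into it: the presence at `0` at time `0` is
  not counted) -/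
  visits : ℤ → ℕ
  /-- `crossings d y`: number of jumps so far along the oriented edge `(y, y + d)` -/
  crossings : Side → ℤ → ℕ
  /-- `clock d y`: time left on the clock attached to the oriented edge `(y, y + d)`
  (meaningful if such a clock has been started and has not rung) -/
  clock : Side → ℤ → ℝ

noncomputable section

namespace Rubin

/-- At time `0` the walker is at `0`, where the two clocks `ξ₀^±(0) / w(0)` are started. -/
def init (w : ℕ → ℝ) (ξ : Side → ℤ → ℕ → ℝ) : RubinState where
  time := 0
  pos := 0
  visits := fun _ => 0
  crossings := fun _ _ => 0
  clock := fun d y => if y = 0 then ξ d 0 0 / w 0 else 0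

/-- The clocks after the clock of direction `d` has rung at the current site `x`, so that the
walker jumps to `y = x + d`.
* At `y`, a new clock is started for the edge `(y, x)`; the clock for the other edge
  `(y, y + d)` is restarted where it was stopped if `y` has been visited before
  (the starting site `0` always has), and otherwise it is a new clock.
* At `x`, the other clock is stopped, and has lost the time just spent at `x`; the one that has
  rung is used up.
* Nothing changes at the other sites. -/
def nextClock (w : ℕ → ℝ) (ξ : Side → ℤ → ℕ → ℝ) (s : RubinState) (d : Side) :
    Side → ℤ → ℝ := fun e z =>
  let x := s.pos
  let y := s.pos + d.sgn
  if z = y then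
    if e = d.opp then ξ e y (s.crossings e y) / w (s.visits x)
    else if y = 0 ∨ 0 < s.visits y then s.clock e y
    else ξ e y 0 / w 0
  else if z = x then s.clock e x - s.clock d x
  else s.clock e z

/-- The jump in direction `d`, which occurs when the clock of direction `d` at the current site
rings. -/
def jump (w : ℕ → ℝ) (ξ : Side → ℤ → ℕ → ℝ) (s : RubinState) (d : Side) : RubinState where
  time := s.time + s.clock d s.pos
  pos := s.pos + d.sgn
  visits := fun z => if z = s.pos + d.sgn then s.visits z + 1 else s.visits z
  crossings := fun e z =>
    if e = d ∧ z = s.pos then s.crossings e z + 1 else s.crossings e z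
  clock := nextClock w ξ s d

/-- The walker jumps along the edge whose clock rings first. If both clocks ring simultaneously,
the construction fails: no further jump ever occurs, so the configuration is frozen. -/
def step (w : ℕ → ℝ) (ξ : Side → ℤ → ℕ → ℝ) (s : RubinState) : RubinState :=
  if s.clock .left s.pos < s.clock .right s.pos then jump w ξ s .left
  else if s.clock .right s.pos < s.clock .left s.pos then jump w ξ s .right
  else s

/-- The configuration right after the `k`-th jump, i.e. at time `τ_k` (the last configuration
reached, if the construction fails before). It records the continuous-time walk: `(state w ξ k).time`
is `τ_k` and the walk sits at `(state w ξ k).pos` during `[τ_k, τ_{k+1})`. -/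
def state (w : ℕ → ℝ) (ξ : Side → ℤ → ℕ → ℝ) : ℕ → RubinState
  | 0 => init w ξ
  | k + 1 => step w ξ (state w ξ k)

/-- The total number `Z_∞(y)` of visits of the walk to `y`. -/
def totalVisits (w : ℕ → ℝ) (ξ : Side → ℤ → ℕ → ℝ) (y : ℤ) : ℕ∞ :=
  ⨆ k : ℕ, ((state w ξ k).visits y : ℕ∞)

/-- The total time `T_y^±` consumed by the clocks attached to the oriented edge `(y, y ± 1)`:
the sum, over the jumps from `y` to `y ± 1`, of the full durations
`ξ^±_N(y) / w(Z(y ± 1))` of the clocks that have rung. -/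
def totalClock (w : ℕ → ℝ) (ξ : Side → ℤ → ℕ → ℝ) (d : Side) (y : ℤ) : ℝ≥0∞ :=
  ∑' k : ℕ,
    if (state w ξ k).pos = y ∧ (state w ξ (k + 1)).pos = y + d.sgn then
      ENNReal.ofReal
        (ξ d y ((state w ξ k).crossings d y) / w ((state w ξ k).visits (y + d.sgn)))
    else 0

/-- `T_y^+ = T_y^- < ∞` while `y - 1` and `y + 1` are both visited infinitely often. -/
def BalancedAt (w : ℕ → ℝ) (ξ : Side → ℤ → ℕ → ℝ) (y : ℤ) : Prop :=
  totalClock w ξ .right y = totalClock w ξ .left y ∧ totalClock w ξ .right y < ∞ ∧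
    totalVisits w ξ (y - 1) = ⊤ ∧ totalVisits w ξ (y + 1) = ⊤

/-- The `ξ_k^±(y)` are independent exponential random variables, `ξ_k^±(y)` with mean
`f^±(y, k)` (that is, with rate `1 / f^±(y, k)`). -/
def IsExpClocks {Ω : Type*} [MeasurableSpace Ω] (P : Measure Ω) (f : Side → ℤ → ℕ → ℝ)
    (ξ : Side → ℤ → ℕ → Ω → ℝ) : Prop :=
  iIndepFun (fun i : Side × ℤ × ℕ => ξ i.1 i.2.1 i.2.2) P ∧
    ∀ d y k, HasLaw (ξ d y k) (expMeasure (1 / f d y k)) P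

end Rubin

namespace StuckWalk

/-- `f^±(y,n) = exp (2β [2(1+α) n - α 1_{y ± 1 = 0} + (1+α) 1_{± y < 0}])`. -/
def f (α β : ℝ) (d : Side) (y : ℤ) (n : ℕ) : ℝ :=
  Real.exp (2 * β * (2 * (1 + α) * n - α * (if y + d.sgn = 0 then 1 else 0)
    + (1 + α) * (if d.sgn * y < 0 then 1 else 0)))

/-- `w(n) = exp (4βα n)`. -/
def w (α β : ℝ) (n : ℕ) : ℝ :=
  Real.exp (4 * β * α * n)

end StuckWalk

end

/-!
The proof varies a single clock. Fix all the clocks except the first one of the edge `(y, y + 1)`.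
At most one value of that clock makes the configuration balanced at `y`; since its law has no atoms
and it is independent of the others, Fubini's theorem concludes.

That claim is a monotonicity property (`not_inverted`). Suppose that the clocks of direction
`d` are slower, and those of direction `d.opp` faster, for a second walk than for a first one. At a
site `z`, record the successive directions of departure as a lattice path in the plane of crossing
numbers. The path of the second walk never lies strictly on the `d` side of the path of the first.
Indeed, at the earliest violation both paths pass through the same point and leave it in opposite
directions, the first walk in direction `d.opp` and the second in direction `d`. A departure takes
the direction of the smaller of two sums of clock durations (`deadline_lt_of_clock_lt`), and these
sums are ordered the wrong way. For when corresponding clocks are started, the second walk has made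
at most as many visits to `z + d`, and at least as many to `z - d`, because the paths at these sites
have been ordered so far (`visits_le_visits`); as `w` is non-decreasing, this only lengthens the
clocks of direction `d` and shortens the others (`deadline_le_deadline`). This is where the
monotonicity of `w` enters.

If both neighbours of `y` are visited infinitely often, then both edges at `y` are crossed
infinitely often, so every clock of `y` eventually contributes to `T_y^±`. Slowing down the first
clock of `(y, y + 1)` therefore does not increase `T_y^-` and strictly increases `T_y^+`; finite
values cannot be equal both before and after (`not_balancedAt_of_lt`).
-/

/-! ### The two directions -/

namespace Side

@[simp] lemma opp_opp (d : Side) : d.opp.opp = d := by cases d <;> rfl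

@[simp] lemma sgn_opp (d : Side) : d.opp.sgn = -d.sgn := by cases d <;> rfl

lemma eq_or_eq_opp (d e : Side) : e = d ∨ e = d.opp := by cases d <;> cases e <;> simp [opp]

@[simp] lemma opp_ne (d : Side) : d.opp ≠ d := by cases d <;> simp [opp]

@[simp] lemma ne_opp (d : Side) : d ≠ d.opp := by cases d <;> simp [opp]

@[simp] lemma sgn_mul_self (d : Side) : d.sgn * d.sgn = 1 := by cases d <;> rfl

lemma sgn_ne_zero (d : Side) : d.sgn ≠ 0 := by cases d <;> simp [sgn]

instance : Finite Side :=
  Finite.of_injective (fun d : Side => decide (d = left)) fun a b h => by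
    cases a <;> cases b <;> simp_all

end Side

noncomputable section

namespace Rubin

variable {w : ℕ → ℝ} {ξ : Side → ℤ → ℕ → ℝ}

/-! ### Elementary steps of the walk -/

lemma step_cases (w : ℕ → ℝ) (ξ : Side → ℤ → ℕ → ℝ) (s : RubinState) :
    step w ξ s = s ∨ ∃ d : Side, s.clock d s.pos < s.clock d.opp s.pos ∧
      step w ξ s = jump w ξ s d := by
  unfold step
  split_ifs with h1 h2
  · exact Or.inr ⟨.left, h1, rfl⟩
  · exact Or.inr ⟨.right, h2, rfl⟩
  · exact Or.inl rfl

lemma state_succ_cases (w : ℕ → ℝ) (ξ : Side → ℤ → ℕ → ℝ) (k : ℕ) :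
    state w ξ (k + 1) = state w ξ k ∨ ∃ d : Side,
      (state w ξ k).clock d (state w ξ k).pos < (state w ξ k).clock d.opp (state w ξ k).pos ∧
      state w ξ (k + 1) = jump w ξ (state w ξ k) d :=
  step_cases w ξ (state w ξ k)

/-- The number of jumps from `z` in direction `d` among the first `k` jumps. -/
abbrev crossings (w : ℕ → ℝ) (ξ : Side → ℤ → ℕ → ℝ) (d : Side) (z : ℤ) (k : ℕ) : ℕ :=
  (state w ξ k).crossings d z

/-- The total duration of the clocks attached to `(z, z + d)` that have rung during the first
`k` jumps: a partial sum of `Rubin.totalClock`. -/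
def spent (w : ℕ → ℝ) (ξ : Side → ℤ → ℕ → ℝ) (d : Side) (z : ℤ) (k : ℕ) : ℝ :=
  ∑ j ∈ Finset.range k,
    if (state w ξ j).pos = z ∧ (state w ξ (j + 1)).pos = z + d.sgn then
      ξ d z ((state w ξ j).crossings d z) / w ((state w ξ j).visits (z + d.sgn))
    else 0

/-- The total duration of the clocks attached to `(z, z + d)` that have rung during the first `k`
jumps, together with that of the next clock at the present weight. When the walker is at `z`, that
clock is running and this is the local time at `z` at which it rings. -/
def deadline (w : ℕ → ℝ) (ξ : Side → ℤ → ℕ → ℝ) (d : Side) (z : ℤ) (k : ℕ) : ℝ :=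
  spent w ξ d z k + ξ d z (crossings w ξ d z k) / w ((state w ξ k).visits (z + d.sgn))

@[simp] lemma crossings_zero (d : Side) (z : ℤ) : crossings w ξ d z 0 = 0 := rfl

@[simp] lemma spent_zero (d : Side) (z : ℤ) : spent w ξ d z 0 = 0 := rfl

lemma spent_succ_of_eq {k : ℕ} (h : state w ξ (k + 1) = state w ξ k) (d : Side) (z : ℤ) :
    spent w ξ d z (k + 1) = spent w ξ d z k := by
  have := d.sgn_ne_zero
  rw [spent, Finset.sum_range_succ, h, if_neg (by omega), add_zero, spent]

lemma spent_succ_of_jump {k : ℕ} {e : Side}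
    (h : state w ξ (k + 1) = jump w ξ (state w ξ k) e) (d : Side) (z : ℤ) :
    spent w ξ d z (k + 1) =
      if d = e ∧ z = (state w ξ k).pos then deadline w ξ d z k else spent w ξ d z k := by
  rw [deadline, spent, Finset.sum_range_succ, h]
  have hp : (jump w ξ (state w ξ k) e).pos = (state w ξ k).pos + e.sgn := rfl
  by_cases hz : z = (state w ξ k).pos
  · rcases e.eq_or_eq_opp d with rfl | rfl
    · simp [hz, hp, spent]
    · have := e.sgn_ne_zero
      rw [if_neg (by rw [hp, Side.sgn_opp]; omega), if_neg (by simp)]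
      simp [spent]
  · rw [if_neg (by tauto), if_neg (by tauto)]
    simp [spent]

lemma crossings_succ_of_jump {k : ℕ} {e : Side}
    (h : state w ξ (k + 1) = jump w ξ (state w ξ k) e) (d : Side) (z : ℤ) :
    crossings w ξ d z (k + 1) =
      if d = e ∧ z = (state w ξ k).pos then crossings w ξ d z k + 1 else crossings w ξ d z k := by
  rw [crossings, h]; rfl

lemma crossings_succ_of_eq {k : ℕ} (h : state w ξ (k + 1) = state w ξ k) (d : Side) (z : ℤ) :
    crossings w ξ d z (k + 1) = crossings w ξ d z k := by
  rw [crossings, h]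

lemma visits_succ_of_jump {k : ℕ} {e : Side}
    (h : state w ξ (k + 1) = jump w ξ (state w ξ k) e) (z : ℤ) :
    (state w ξ (k + 1)).visits z =
      if z = (state w ξ k).pos + e.sgn then (state w ξ k).visits z + 1
      else (state w ξ k).visits z := by
  rw [h]; rfl

lemma pos_succ_of_jump {k : ℕ} {e : Side}
    (h : state w ξ (k + 1) = jump w ξ (state w ξ k) e) :
    (state w ξ (k + 1)).pos = (state w ξ k).pos + e.sgn := by
  rw [h]; rfl

/-- At each step, either `z` is not left in direction `d`, or it is and the clock of this
direction has rung. -/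
lemma crossings_succ_cases (w : ℕ → ℝ) (ξ : Side → ℤ → ℕ → ℝ) (d : Side) (z : ℤ) (k : ℕ) :
    (crossings w ξ d z (k + 1) = crossings w ξ d z k ∧
      spent w ξ d z (k + 1) = spent w ξ d z k) ∨
    ((state w ξ k).pos = z ∧ state w ξ (k + 1) = jump w ξ (state w ξ k) d ∧
      (state w ξ k).clock d z < (state w ξ k).clock d.opp z ∧
      crossings w ξ d z (k + 1) = crossings w ξ d z k + 1 ∧
      spent w ξ d z (k + 1) = deadline w ξ d z k) := by
  rcases state_succ_cases w ξ k with h | ⟨e, hlt, h⟩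
  · exact Or.inl ⟨crossings_succ_of_eq h d z, spent_succ_of_eq h d z⟩
  · rw [crossings_succ_of_jump h, spent_succ_of_jump h]
    by_cases hc : d = e ∧ z = (state w ξ k).pos
    · obtain ⟨rfl, rfl⟩ := hc
      simp [h, hlt]
    · simp [hc]

/-! ### Clocks and local times -/

/-- Whether the site `z` has been occupied: the walk starts at `0`, which is not recorded as a
visit. -/
abbrev Started (w : ℕ → ℝ) (ξ : Side → ℤ → ℕ → ℝ) (z : ℤ) (k : ℕ) : Prop :=
  z = 0 ∨ 0 < (state w ξ k).visits z

lemma started_pos (w : ℕ → ℝ) (ξ : Side → ℤ → ℕ → ℝ) (k : ℕ) :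
    Started w ξ (state w ξ k).pos k := by
  induction k with
  | zero => exact Or.inl rfl
  | succ k ih =>
    rcases state_succ_cases w ξ k with h | ⟨e, -, h⟩
    · rwa [Started, h]
    · right
      rw [visits_succ_of_jump h, if_pos (pos_succ_of_jump h)]
      omega

lemma visits_le_succ (w : ℕ → ℝ) (ξ : Side → ℤ → ℕ → ℝ) (z : ℤ) (k : ℕ) :
    (state w ξ k).visits z ≤ (state w ξ (k + 1)).visits z := by
  rcases state_succ_cases w ξ k with h | ⟨e, -, h⟩
  · rw [h]
  · rw [visits_succ_of_jump h]
    split_ifs <;> omega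

/-- The sites beyond a site that has not been occupied have not been visited. -/
lemma visits_eq_zero_of_not_started {d : Side} {z : ℤ} {k : ℕ} (hz : ¬ Started w ξ z k)
    (hd : d.sgn * ((state w ξ k).pos - z) < 0) : (state w ξ k).visits (z + d.sgn) = 0 := by
  induction k with
  | zero => rfl
  | succ k ih =>
    have hz' : ¬ Started w ξ z k := by
      have := visits_le_succ w ξ z k
      simp only [Started] at hz ⊢
      omega
    have hne : (state w ξ k).pos ≠ z := fun h => hz' (h ▸ started_pos w ξ k)
    rcases state_succ_cases w ξ k with h | ⟨e, -, h⟩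
    · rw [h] at hd ⊢
      exact ih hz' hd
    · rw [pos_succ_of_jump h] at hd
      rw [visits_succ_of_jump h, if_neg, ih hz']
      · cases d <;> cases e <;> simp only [Side.sgn] at * <;> omega
      · cases d <;> cases e <;> simp only [Side.sgn] at * <;> omega

lemma crossings_eq_zero_of_not_started {d : Side} {z : ℤ} {k : ℕ} (hz : ¬ Started w ξ z k) :
    crossings w ξ d z k = 0 ∧ spent w ξ d z k = 0 := by
  induction k with
  | zero => exact ⟨rfl, rfl⟩
  | succ k ih =>
    have hz' : ¬ Started w ξ z k := by
      have := visits_le_succ w ξ z k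
      simp only [Started] at hz ⊢
      omega
    have hne : (state w ξ k).pos ≠ z := fun h => hz' (h ▸ started_pos w ξ k)
    rcases crossings_succ_cases w ξ d z k with ⟨h, h'⟩ | ⟨h, -⟩
    · rw [h, h']
      exact ih hz'
    · exact absurd h hne

/-- The clocks of a site all measure the same local time `loc`. A clock that is running or has
been stopped shows the time from `loc` to its deadline; at a site that has been left in
direction `d` the clock of this direction has just rung, and `loc` is the time it has consumed. -/
lemma exists_localTime (w : ℕ → ℝ) (ξ : Side → ℤ → ℕ → ℝ) (k : ℕ) :
    ∃ loc : ℤ → ℝ, ∀ (d : Side) (z : ℤ),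
      (0 < d.sgn * ((state w ξ k).pos - z) → spent w ξ d z k = loc z) ∧
      (Started w ξ z k → d.sgn * ((state w ξ k).pos - z) ≤ 0 →
        (state w ξ k).clock d z = deadline w ξ d z k - loc z) ∧
      (¬ Started w ξ z k → loc z = 0) := by
  induction k with
  | zero =>
    refine ⟨0, fun d z => ⟨fun _ => rfl, fun h _ => ?_, fun _ => rfl⟩⟩
    obtain rfl : z = 0 := by
      rcases h with h | h
      · exact h
      · exact absurd h (lt_irrefl 0)
    simp [deadline, crossings, state, init]
  | succ k ih =>
    obtain ⟨loc, hloc⟩ := ih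
    rcases state_succ_cases w ξ k with h | ⟨e, hlt, h⟩
    · refine ⟨loc, fun d z => ?_⟩
      have := hloc d z
      simp only [Started, deadline, crossings, spent_succ_of_eq h, h] at this ⊢
      exact this
    set x := (state w ξ k).pos with hx
    have hxs : Started w ξ x k := started_pos w ξ k
    have hpos : (state w ξ (k + 1)).pos = x + e.sgn := pos_succ_of_jump h
    refine ⟨fun z => if z = x then spent w ξ e x (k + 1) else loc z, fun d z => ?_⟩
    have hclock : (state w ξ (k + 1)).clock d z =
        if z = x + e.sgn then
          if d = e.opp then
            ξ d (x + e.sgn) (crossings w ξ d (x + e.sgn) k) / w ((state w ξ k).visits x)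
          else if Started w ξ (x + e.sgn) k then (state w ξ k).clock d (x + e.sgn)
          else ξ d (x + e.sgn) 0 / w 0
        else if z = x then (state w ξ k).clock d x - (state w ξ k).clock e x
        else (state w ξ k).clock d z := by
      rw [h]; rfl
    have hxe : spent w ξ e x (k + 1) = deadline w ξ e x k := by
      rw [spent_succ_of_jump h, if_pos ⟨rfl, rfl⟩]
    have hxc := (hloc e x).2.1 hxs (by simp)
    have he0 := e.sgn_ne_zero
    beta_reduce
    -- the site that is left, the site that is entered, and the others
    by_cases hzx : z = x
    · subst hzx
      rw [if_pos rfl]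
      refine ⟨fun hd => ?_, fun _ hd => ?_, fun hn => ?_⟩
      · rw [hpos] at hd
        obtain rfl : d = e := by cases d <;> cases e <;> simp [Side.sgn] at hd ⊢
        rfl
      · rw [hpos] at hd
        obtain rfl : d = e.opp := by cases d <;> cases e <;> simp [Side.sgn, Side.opp] at hd ⊢
        have hc := (hloc e.opp x).2.1 hxs (by simp)
        have hdl : deadline w ξ e.opp x (k + 1) = deadline w ξ e.opp x k := by
          rw [deadline, deadline, spent_succ_of_jump h, if_neg (by simp),
            crossings_succ_of_jump h, if_neg (by simp), visits_succ_of_jump h,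
            if_neg (by rw [Side.sgn_opp]; omega)]
        rw [hclock, if_neg (by omega), if_pos rfl, hc, hxc, hxe, hdl]
        ring
      · refine absurd ?_ hn
        have := visits_le_succ w ξ x k
        simp only [Started] at hxs ⊢
        omega
    · rw [if_neg hzx]
      have hsp : spent w ξ d z (k + 1) = spent w ξ d z k := by
        rw [spent_succ_of_jump h, if_neg (by tauto)]
      have hcr : crossings w ξ d z (k + 1) = crossings w ξ d z k := by
        rw [crossings_succ_of_jump h, if_neg (by tauto)]
      refine ⟨fun hd => ?_, fun hs hd => ?_, fun hn => ?_⟩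
      · rw [hsp]
        by_cases hzy : z = x + e.sgn
        · rw [hpos, hzy] at hd
          simp at hd
        · refine (hloc d z).1 ?_
          rw [hpos] at hd
          cases d <;> cases e <;> simp only [Side.sgn] at * <;> omega
      · by_cases hzy : z = x + e.sgn
        · have hv : (state w ξ (k + 1)).visits (z + d.sgn) = (state w ξ k).visits (z + d.sgn) := by
            rw [visits_succ_of_jump h, if_neg]
            have := d.sgn_ne_zero
            omega
          rw [hclock, if_pos hzy, deadline, hsp, hcr, hv, ← hzy]
          rcases e.eq_or_eq_opp d with rfl | rfl
          · rw [if_neg (by simp)]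
            by_cases hzs : Started w ξ z k
            · rw [if_pos hzs]
              exact (hloc d z).2.1 hzs (by rw [hzy]; cases d <;> simp [Side.sgn])
            -- a first visit: all the terms of the deadline but the new clock vanish
            · have hv0 : (state w ξ k).visits (z + d.sgn) = 0 :=
                visits_eq_zero_of_not_started hzs
                  (by rw [← hx, hzy]; cases d <;> simp [Side.sgn])
              rw [if_neg hzs, (hloc d z).2.2 hzs, (crossings_eq_zero_of_not_started hzs).1,
                (crossings_eq_zero_of_not_started hzs).2, hv0]
              simp
          · rw [if_pos rfl, (hloc e.opp z).1 (by rw [hzy]; cases e <;> simp [Side.sgn, Side.opp]),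
              show z + e.opp.sgn = x by rw [Side.sgn_opp]; omega]
            simp
        · have hs' : Started w ξ z k := by
            simpa only [Started, visits_succ_of_jump h, ← hx, if_neg hzy] using hs
          have hd' : d.sgn * (x - z) ≤ 0 := by
            rw [hpos] at hd
            cases d <;> cases e <;> simp only [Side.sgn] at * <;> omega
          rw [hclock, if_neg hzy, if_neg hzx, (hloc d z).2.1 hs' hd', deadline,
            deadline, hsp, hcr, visits_succ_of_jump h, if_neg]
          cases d <;> cases e <;> simp only [Side.sgn] at * <;> omega
      · refine (hloc d z).2.2 fun hs => hn ?_
        have := visits_le_succ w ξ z k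
        simp only [Started] at hs ⊢
        omega

/-- The walk leaves its present site in the direction of the earlier deadline. -/
lemma deadline_lt_of_clock_lt {d : Side} {z : ℤ} {k : ℕ} (hz : (state w ξ k).pos = z)
    (h : (state w ξ k).clock d z < (state w ξ k).clock d.opp z) :
    deadline w ξ d z k < deadline w ξ d.opp z k := by
  subst hz
  obtain ⟨loc, hloc⟩ := exists_localTime w ξ k
  have h1 := (hloc d _).2.1 (started_pos w ξ k) (by simp)
  have h2 := (hloc d.opp _).2.1 (started_pos w ξ k) (by simp)
  linarith

/-! ### Counting crossings and visits -/

/-- An edge is crossed alternately in its two directions. -/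
lemma crossings_add_eq (w : ℕ → ℝ) (ξ : Side → ℤ → ℕ → ℝ) (d : Side) (z : ℤ) (k : ℕ) :
    crossings w ξ d z k + (if 0 < d.sgn * (0 - z) then 1 else 0) =
      crossings w ξ d.opp (z + d.sgn) k +
        (if 0 < d.sgn * ((state w ξ k).pos - z) then 1 else 0) := by
  induction k with
  | zero => rfl
  | succ k ih =>
    rcases state_succ_cases w ξ k with h | ⟨e, -, h⟩
    · rwa [crossings_succ_of_eq h, crossings_succ_of_eq h, h]
    · rw [crossings_succ_of_jump h, crossings_succ_of_jump h, pos_succ_of_jump h]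
      cases d <;> cases e <;> simp only [Side.sgn, Side.opp, reduceCtorEq, false_and, true_and,
        if_false] at ih ⊢ <;> grind

/-- Each visit to a site is followed by a departure, except at the present site. -/
lemma crossings_add_crossings_opp (w : ℕ → ℝ) (ξ : Side → ℤ → ℕ → ℝ) (d : Side) (z : ℤ) (k : ℕ) :
    crossings w ξ d z k + crossings w ξ d.opp z k + (if (state w ξ k).pos = z then 1 else 0) =
      (state w ξ k).visits z + (if z = 0 then 1 else 0) := by
  induction k with
  | zero => simp [crossings, state, init, eq_comm]
  | succ k ih =>
    rcases state_succ_cases w ξ k with h | ⟨e, -, h⟩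
    · rwa [crossings_succ_of_eq h, crossings_succ_of_eq h, h]
    · rw [crossings_succ_of_jump h, crossings_succ_of_jump h, pos_succ_of_jump h,
        visits_succ_of_jump h]
      cases d <;> cases e <;> simp only [Side.sgn, Side.opp, reduceCtorEq, false_and, true_and,
        if_false] at ih ⊢ <;> grind

/-- A site which has the walker on its side `d.opp` was last left in direction `d.opp`, unless
it has not been left at all. -/
lemma exists_last_departure {d : Side} {z : ℤ} {k : ℕ} (hd : d.sgn * ((state w ξ k).pos - z) < 0) :
    crossings w ξ d z k = 0 ∨ ∃ j < k, crossings w ξ d z j = crossings w ξ d z k ∧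
      crossings w ξ d.opp z j + 1 = crossings w ξ d.opp z k := by
  induction k with
  | zero => exact Or.inl rfl
  | succ k ih =>
    rcases state_succ_cases w ξ k with h | ⟨e, -, h⟩
    · rw [h] at hd
      rw [crossings_succ_of_eq h, crossings_succ_of_eq h]
      exact (ih hd).imp_right fun ⟨j, hj, hj'⟩ => ⟨j, by omega, hj'⟩
    · rw [pos_succ_of_jump h] at hd
      rw [crossings_succ_of_jump h, crossings_succ_of_jump h]
      by_cases hz : z = (state w ξ k).pos
      · have he : e = d.opp := by
          cases d <;> cases e <;> simp only [Side.sgn, Side.opp, reduceCtorEq] at hd ⊢ <;> omega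
        refine Or.inr ⟨k, by omega, ?_, ?_⟩
        · rw [if_neg (by simp [he])]
        · rw [if_pos ⟨he.symm, hz⟩]
      · have hd' : d.sgn * ((state w ξ k).pos - z) < 0 := by
          cases d <;> cases e <;> simp only [Side.sgn] at * <;> omega
        rw [if_neg (by tauto), if_neg (by tauto)]
        exact (ih hd').imp_right fun ⟨j, hj, hj'⟩ => ⟨j, by omega, hj'⟩

/-! ### Comparison of two walks -/

/-- Two walks are inverted at `z` after `k` and `n` jumps if the second has left `z` more often in
direction `d` and less often in direction `d.opp` than the first. -/
def Inverted (w : ℕ → ℝ) (ξ ξ' : Side → ℤ → ℕ → ℝ) (d : Side) (z : ℤ) (k n : ℕ) : Prop :=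
  crossings w ξ d z k < crossings w ξ' d z n ∧
    crossings w ξ' d.opp z n < crossings w ξ d.opp z k

variable {ξ' : Side → ℤ → ℕ → ℝ}

lemma inverted_opp {d : Side} {z : ℤ} {k n : ℕ} :
    Inverted w ξ' ξ d.opp z n k ↔ Inverted w ξ ξ' d z k n := by
  simp only [Inverted, Side.opp_opp]
  exact and_comm

/-- As long as there is no inversion, the weights seen by the corresponding clocks of direction `d`
are ordered: when the two walks are at `z` with the same number of crossings of `(z, z + d)`, the
second has made at most as many visits to `z + d`. -/
lemma visits_le_visits {d : Side} {z : ℤ} {k n : ℕ}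
    (hI : ∀ j ≤ n, ¬ Inverted w ξ ξ' d (z + d.sgn) k j)
    (hk : (state w ξ k).pos = z) (hn : (state w ξ' n).pos = z)
    (hc : crossings w ξ d z k = crossings w ξ' d z n) :
    (state w ξ' n).visits (z + d.sgn) ≤ (state w ξ k).visits (z + d.sgn) := by
  have h1 := crossings_add_eq w ξ d z k
  have h2 := crossings_add_eq w ξ' d z n
  have h3 := crossings_add_crossings_opp w ξ d (z + d.sgn) k
  have h4 := crossings_add_crossings_opp w ξ' d (z + d.sgn) n
  have := d.sgn_ne_zero
  simp only [hk, hn, sub_self, mul_zero, lt_irrefl, if_false, add_zero] at h1 h2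
  rw [hk, if_neg (by omega)] at h3
  rw [hn, if_neg (by omega)] at h4
  by_contra! hlt
  have hd : d.sgn * ((state w ξ' n).pos - (z + d.sgn)) < 0 := by
    rw [hn]; cases d <;> simp [Side.sgn]
  rcases exists_last_departure hd with h | ⟨j, hj, hj1, hj2⟩
  · omega
  · exact hI j hj.le ⟨by omega, by omega⟩

lemma div_le_div_of_visits_le {d : Side} {z : ℤ} {k n : ℕ} (hw : ∀ i, 0 < w i) (hmono : Monotone w)
    (hξ : ∀ m, 0 ≤ ξ d z m) (hle : ∀ m, ξ d z m ≤ ξ' d z m)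
    (hI : ∀ j ≤ n, ¬ Inverted w ξ ξ' d (z + d.sgn) k j)
    (hk : (state w ξ k).pos = z) (hn : (state w ξ' n).pos = z)
    (hc : crossings w ξ d z k = crossings w ξ' d z n) :
    ξ d z (crossings w ξ d z k) / w ((state w ξ k).visits (z + d.sgn)) ≤
      ξ' d z (crossings w ξ' d z n) / w ((state w ξ' n).visits (z + d.sgn)) := by
  have hv := hmono (visits_le_visits hI hk hn hc)
  have := hw ((state w ξ' n).visits (z + d.sgn))
  rw [← hc]
  exact div_le_div₀ ((hξ _).trans (hle _)) (hle _) this hv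

lemma crossings_mono (w : ℕ → ℝ) (ξ : Side → ℤ → ℕ → ℝ) (d : Side) (z : ℤ) :
    Monotone (crossings w ξ d z) :=
  monotone_nat_of_le_succ fun k => by
    rcases crossings_succ_cases w ξ d z k with ⟨h, -⟩ | ⟨-, -, -, h, -⟩ <;> omega

lemma spent_mono (hw : ∀ i, 0 < w i) {d : Side} {z : ℤ} (hξ : ∀ m, 0 ≤ ξ d z m) :
    Monotone (spent w ξ d z) :=
  monotone_nat_of_le_succ fun k => by
    rcases crossings_succ_cases w ξ d z k with ⟨-, h⟩ | ⟨-, -, -, -, h⟩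
    · exact h.ge
    · rw [h, deadline]
      have := div_nonneg (hξ (crossings w ξ d z k)) (hw ((state w ξ k).visits (z + d.sgn))).le
      linarith

/-- As long as there is no inversion, corresponding increments of the time consumed by the clocks
of direction `d` are larger for the second walk. -/
lemma spent_add_le_spent_add {d : Side} {z : ℤ} {k₀ n₀ : ℕ} (hw : ∀ i, 0 < w i)
    (hmono : Monotone w) (hξ : ∀ m, 0 ≤ ξ d z m) (hle : ∀ m, ξ d z m ≤ ξ' d z m)
    (h0 : crossings w ξ d z k₀ = crossings w ξ' d z n₀) (a b : ℕ)
    (hI : ∀ i < k₀ + a, ∀ j < n₀ + b, ¬ Inverted w ξ ξ' d (z + d.sgn) i j)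
    (hc : crossings w ξ d z (k₀ + a) = crossings w ξ' d z (n₀ + b)) :
    spent w ξ d z (k₀ + a) + spent w ξ' d z n₀ ≤ spent w ξ' d z (n₀ + b) + spent w ξ d z k₀ := by
  induction hN : a + b using Nat.strong_induction_on generalizing a b with
  | _ N ih =>
  rcases a with _ | a
  · have hξ' : ∀ m, 0 ≤ ξ' d z m := fun m => (hξ m).trans (hle m)
    have := spent_mono hw hξ' (Nat.le_add_right n₀ b)
    rw [add_zero]
    linarith
  rcases crossings_succ_cases w ξ d z (k₀ + a) with ⟨h1, h2⟩ | ⟨hp, -, -, h1, h2⟩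
  · rw [← add_assoc] at hc ⊢
    rw [h2]
    exact ih (a + b) (by omega) a b (fun i hi j hj => hI i (by omega) j hj) (h1 ▸ hc) rfl
  rw [← add_assoc] at hc ⊢
  rcases b with _ | b
  · have := crossings_mono w ξ d z (Nat.le_add_right k₀ a)
    rw [add_zero] at hc
    omega
  rw [← add_assoc] at hc ⊢
  rcases crossings_succ_cases w ξ' d z (n₀ + b) with ⟨h1', h2'⟩ | ⟨hp', -, -, h1', h2'⟩
  · rw [h2']
    exact ih (a + 1 + b) (by omega) (a + 1) b (fun i hi j hj => hI i hi j (by omega))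
      (by rw [← add_assoc, hc, h1']) rfl
  · have hc' : crossings w ξ d z (k₀ + a) = crossings w ξ' d z (n₀ + b) := by omega
    have := ih (a + b) (by omega) a b (fun i hi j hj => hI i (by omega) j (by omega)) hc' rfl
    have := div_le_div_of_visits_le hw hmono hξ hle
      (fun j hj => hI (k₀ + a) (by omega) j (by omega)) hp hp' hc'
    rw [h2, h2', deadline, deadline]
    linarith

lemma deadline_le_deadline {d : Side} {z : ℤ} {k n : ℕ} (hw : ∀ i, 0 < w i) (hmono : Monotone w)
    (hξ : ∀ m, 0 ≤ ξ d z m) (hle : ∀ m, ξ d z m ≤ ξ' d z m)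
    (hI : ∀ i ≤ k, ∀ j ≤ n, ¬ Inverted w ξ ξ' d (z + d.sgn) i j)
    (hk : (state w ξ k).pos = z) (hn : (state w ξ' n).pos = z)
    (hc : crossings w ξ d z k = crossings w ξ' d z n) :
    deadline w ξ d z k ≤ deadline w ξ' d z n := by
  have h1 := spent_add_le_spent_add (k₀ := 0) (n₀ := 0) hw hmono hξ hle rfl k n
    (fun i hi j hj => hI i (by omega) j (by omega)) (by simpa using hc)
  have h2 := div_le_div_of_visits_le hw hmono hξ hle (hI k le_rfl) hk hn hc
  simp only [zero_add, spent_zero, add_zero] at h1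
  exact add_le_add h1 h2

/-- If the clocks of direction `d` are slower and the clocks of direction `d.opp` faster for the
second walk, then no inversion ever occurs. At a first inversion, the two walks would leave `z`
in opposite directions from the same crossing numbers, the first one in direction `d.opp`,
against the order of the deadlines. -/
theorem not_inverted {d : Side} (hw : ∀ i, 0 < w i) (hmono : Monotone w)
    (hξ : ∀ e z m, 0 ≤ ξ e z m) (hξ' : ∀ e z m, 0 ≤ ξ' e z m)
    (hle : ∀ z m, ξ d z m ≤ ξ' d z m) (hge : ∀ z m, ξ' d.opp z m ≤ ξ d.opp z m)
    (z : ℤ) (k n : ℕ) : ¬ Inverted w ξ ξ' d z k n := by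
  induction hN : k + n using Nat.strong_induction_on generalizing z k n with
  | _ N ih =>
  rintro ⟨hd, ho⟩
  rcases k with _ | k
  · simp at ho
  rcases n with _ | n
  · simp at hd
  have hk : ¬ Inverted w ξ ξ' d z k (n + 1) := ih _ (by omega) z k (n + 1) rfl
  have hn : ¬ Inverted w ξ ξ' d z (k + 1) n := ih _ (by omega) z (k + 1) n rfl
  have hkd := crossings_mono w ξ d z (Nat.le_add_right k 1)
  have hno := crossings_mono w ξ' d.opp z (Nat.le_add_right n 1)
  simp only [Inverted, not_and, not_lt] at hk hn
  rcases crossings_succ_cases w ξ d.opp z k with ⟨h, -⟩ | ⟨hp, hj, hclk, hc, -⟩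
  · omega
  rcases crossings_succ_cases w ξ' d z n with ⟨h, -⟩ | ⟨hp', hj', hclk', hc', -⟩
  · omega
  have hcd : crossings w ξ d z (k + 1) = crossings w ξ d z k := by
    rw [crossings_succ_of_jump hj, if_neg (by simp)]
  have hco : crossings w ξ' d.opp z (n + 1) = crossings w ξ' d.opp z n := by
    rw [crossings_succ_of_jump hj', if_neg (by simp)]
  have h1 := deadline_lt_of_clock_lt hp hclk
  have h2 := deadline_lt_of_clock_lt hp' hclk'
  have h3 : deadline w ξ d z k ≤ deadline w ξ' d z n :=
    deadline_le_deadline hw hmono (hξ d z) (hle z)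
      (fun i hi j hj => ih _ (by omega) _ i j rfl) hp hp' (by omega)
  have h4 : deadline w ξ' d.opp z n ≤ deadline w ξ d.opp z k :=
    deadline_le_deadline hw hmono (hξ' d.opp z) (hge z)
      (fun i hi j hj => inverted_opp.not.mpr (ih _ (by omega) _ j i rfl)) hp' hp (by omega)
  rw [Side.opp_opp] at h1
  linarith

/-! ### Sites visited infinitely often and total clock times -/

lemma crossings_lt_of_pos {d : Side} {z : ℤ} {k n : ℕ} (hkn : k ≤ n)
    (hk : d.sgn * ((state w ξ k).pos - z) ≤ 0) (hn : 0 < d.sgn * ((state w ξ n).pos - z)) :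
    crossings w ξ d z k < crossings w ξ d z n := by
  have h1 := crossings_add_eq w ξ d z k
  have h2 := crossings_add_eq w ξ d z n
  have h3 := crossings_mono w ξ d.opp (z + d.sgn) hkn
  rw [if_neg (not_lt.mpr hk)] at h1
  rw [if_pos hn] at h2
  omega

/-- A site with infinitely many visits is occupied at arbitrarily late times. -/
lemma exists_pos_eq_of_totalVisits {z : ℤ} (h : totalVisits w ξ z = ⊤) (k : ℕ) :
    ∃ n, k ≤ n ∧ (state w ξ n).pos = z := by
  by_contra! hne
  have hv : ∀ n, (state w ξ n).visits z ≤ (state w ξ k).visits z := by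
    intro n
    rcases le_total n k with hn | hn
    · exact monotone_nat_of_le_succ (visits_le_succ w ξ z) hn
    · induction n, hn using Nat.le_induction with
      | base => exact le_rfl
      | succ n hn ih =>
        rcases state_succ_cases w ξ n with h' | ⟨e, -, h'⟩
        · rwa [h']
        · rw [visits_succ_of_jump h', if_neg]
          · exact ih
          · rw [← pos_succ_of_jump h']
            exact (hne (n + 1) (by omega)).symm
  have : totalVisits w ξ z ≤ ((state w ξ k).visits z : ℕ∞) :=
    iSup_le fun n => by exact_mod_cast hv n
  rw [h] at this
  exact absurd this (by simp)

/-- If both neighbours of `z` are visited infinitely often, then so are both edges at `z`, and the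
number of crossings takes every value. -/
lemma exists_crossings_eq {d : Side} {z : ℤ} (h : totalVisits w ξ (z + d.sgn) = ⊤)
    (h' : totalVisits w ξ (z - d.sgn) = ⊤) (m : ℕ) : ∃ k, crossings w ξ d z k = m := by
  have hub : ∀ m, ∃ k, m ≤ crossings w ξ d z k := by
    intro m
    induction m with
    | zero => exact ⟨0, le_rfl⟩
    | succ m ih =>
      obtain ⟨k, hk⟩ := ih
      obtain ⟨i, hki, hi⟩ := exists_pos_eq_of_totalVisits h' k
      obtain ⟨j, hij, hj⟩ := exists_pos_eq_of_totalVisits h i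
      have := crossings_mono w ξ d z hki
      have := crossings_lt_of_pos (d := d) (z := z) hij (by rw [hi]; simp) (by rw [hj]; simp)
      exact ⟨j, by omega⟩
  have hex := hub m
  classical
  refine ⟨Nat.find hex, le_antisymm ?_ (Nat.find_spec hex)⟩
  by_contra! hlt
  rcases hk : Nat.find hex with _ | k
  · simp [hk] at hlt
  · rw [hk] at hlt
    refine Nat.find_min hex (m := k) (by omega) ?_
    rcases crossings_succ_cases w ξ d z k with ⟨h, -⟩ | ⟨-, -, -, h, -⟩ <;> omega

lemma totalClock_eq_iSup (hw : ∀ i, 0 < w i) {d : Side} {z : ℤ} (hξ : ∀ m, 0 ≤ ξ d z m) :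
    totalClock w ξ d z = ⨆ k, ENNReal.ofReal (spent w ξ d z k) := by
  rw [totalClock, ENNReal.tsum_eq_iSup_nat]
  refine iSup_congr fun k => ?_
  rw [spent, ENNReal.ofReal_sum_of_nonneg]
  · refine Finset.sum_congr rfl fun j _ => ?_
    split_ifs <;> simp
  · intro j _
    split_ifs
    · exact div_nonneg (hξ _) (hw _).le
    · exact le_rfl

lemma isLUB_spent (hw : ∀ i, 0 < w i) {d : Side} {z : ℤ} (hξ : ∀ m, 0 ≤ ξ d z m)
    (hfin : totalClock w ξ d z < ∞) :
    IsLUB (Set.range (spent w ξ d z)) (totalClock w ξ d z).toReal := by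
  have h0 : ∀ k, 0 ≤ spent w ξ d z k := fun k => spent_mono hw hξ (Nat.zero_le k)
  constructor
  · rintro _ ⟨k, rfl⟩
    rw [← ENNReal.ofReal_le_iff_le_toReal hfin.ne, totalClock_eq_iSup hw hξ]
    exact le_iSup (fun k => ENNReal.ofReal (spent w ξ d z k)) k
  · intro c hc
    refine ENNReal.toReal_le_of_le_ofReal ((h0 0).trans (hc ⟨0, rfl⟩)) ?_
    rw [totalClock_eq_iSup hw hξ]
    exact iSup_le fun k => ENNReal.ofReal_le_ofReal (hc ⟨k, rfl⟩)

/-! ### Balance is destroyed by slowing down one clock -/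

/-- Slowing down the first clock of `(y, y + 1)` alone destroys the balance at `y`: it does not
increase `T_y^-`, but it increases `T_y^+`. -/
theorem not_balancedAt_of_lt {y : ℤ} (hw : ∀ i, 0 < w i) (hmono : Monotone w)
    (hξ : ∀ e z m, 0 ≤ ξ e z m) (hξ' : ∀ e z m, 0 ≤ ξ' e z m)
    (hne : ∀ e z m, (e, z, m) ≠ (Side.right, y, 0) → ξ' e z m = ξ e z m)
    (hlt : ξ .right y 0 < ξ' .right y 0) (hB : BalancedAt w ξ y) : ¬ BalancedAt w ξ' y := by
  intro hB'
  obtain ⟨heq, hfin, hl, hr⟩ := hB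
  obtain ⟨heq', hfin', hl', hr'⟩ := hB'
  have hle : ∀ z m, ξ .right z m ≤ ξ' .right z m := by
    intro z m
    by_cases h : ((Side.right, z, m) : Side × ℤ × ℕ) = (Side.right, y, 0)
    · simp only [Prod.mk.injEq, true_and] at h
      rw [h.1, h.2]
      exact hlt.le
    · exact (hne _ _ _ h).ge
  have hge : ∀ z m, ξ' .left z m ≤ ξ .left z m := fun z m => (hne _ _ _ (by simp)).le
  have hI : ∀ z k n, ¬ Inverted w ξ ξ' .right z k n := not_inverted hw hmono hξ hξ' hle hge
  have hI' : ∀ z k n, ¬ Inverted w ξ' ξ .left z n k := fun z k n =>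
    (inverted_opp (d := .right)).not.mpr (hI z k n)
  have hR := isLUB_spent hw (hξ .right y) hfin
  have hR' := isLUB_spent hw (hξ' .right y) hfin'
  have hL := isLUB_spent hw (hξ .left y) (heq ▸ hfin)
  have hL' := isLUB_spent hw (hξ' .left y) (heq' ▸ hfin')
  rw [← heq] at hL
  rw [← heq'] at hL'
  have hTL : (totalClock w ξ' .right y).toReal ≤ (totalClock w ξ .right y).toReal := by
    refine hL'.2 ?_
    rintro _ ⟨n, rfl⟩
    obtain ⟨k, hk⟩ := exists_crossings_eq (w := w) (ξ := ξ) (d := .left) (z := y) hl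
      (by simpa [Side.sgn] using hr) (crossings w ξ' .left y n)
    have := spent_add_le_spent_add (k₀ := 0) (n₀ := 0) hw hmono (hξ' .left y) (hge y) rfl n k
      (fun i _ j _ => hI' _ j i) (by simp [hk])
    simp only [zero_add, spent_zero, add_zero] at this
    exact this.trans (hL.1 ⟨k, rfl⟩)
  have hcr : ∀ m, ∃ k, crossings w ξ .right y k = m :=
    exists_crossings_eq (d := .right) hr hl
  have hcr' : ∀ m, ∃ k, crossings w ξ' .right y k = m :=
    exists_crossings_eq (d := .right) hr' hl'
  -- The first jump from `y` to `y + 1` uses the modified clock, which makes the gain strict.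
  have hfirst : ∀ η : Side → ℤ → ℕ → ℝ, (∀ m, ∃ k, crossings w η .right y k = m) →
      ∃ k, (state w η k).pos = y ∧ crossings w η .right y k = 0 ∧
        crossings w η .right y (k + 1) = 1 ∧
        spent w η .right y (k + 1) = deadline w η .right y k := by
    intro η hη
    have hex : ∃ k, 0 < crossings w η .right y k := (hη 1).imp fun k hk => by omega
    classical
    rcases hk : Nat.find hex with _ | k
    · have := Nat.find_spec hex
      rw [hk] at this
      simp at this
    · have h1 := Nat.find_spec hex
      have h2 := Nat.find_min hex (m := k) (by omega)
      rw [hk] at h1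
      rcases crossings_succ_cases w η .right y k with ⟨h, -⟩ | ⟨hp, -, -, h, hs⟩
      · omega
      · exact ⟨k, hp, by omega, by omega, hs⟩
  have hspent0 : ∀ (η : Side → ℤ → ℕ → ℝ) k, crossings w η .right y k = 0 →
      spent w η .right y k = 0 := by
    intro η k
    induction k with
    | zero => simp
    | succ k ih =>
      rcases crossings_succ_cases w η .right y k with ⟨h, h'⟩ | ⟨-, -, -, h, -⟩
      · rw [h, h']; exact ih
      · omega
  obtain ⟨k₀, hp, hc0, hc1, hs⟩ := hfirst ξ hcr
  obtain ⟨n₀, hp', hc0', hc1', hs'⟩ := hfirst ξ' hcr'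
  have hstrict : spent w ξ .right y (k₀ + 1) < spent w ξ' .right y (n₀ + 1) := by
    have hv := hmono (visits_le_visits (fun j _ => hI _ k₀ j) hp hp' (hc0.trans hc0'.symm))
    rw [hs, hs', deadline, deadline, hspent0 ξ k₀ hc0, hspent0 ξ' n₀ hc0', hc0, hc0', zero_add,
      zero_add]
    have h1 := hw ((state w ξ k₀).visits (y + Side.right.sgn))
    have h2 := hw ((state w ξ' n₀).visits (y + Side.right.sgn))
    calc _ < ξ' .right y 0 / w ((state w ξ k₀).visits (y + Side.right.sgn)) :=
          div_lt_div_of_pos_right hlt h1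
      _ ≤ _ := div_le_div_of_nonneg_left (hξ' _ _ _) h2 hv
  have hTR : (totalClock w ξ .right y).toReal ≤ (totalClock w ξ' .right y).toReal +
      spent w ξ .right y (k₀ + 1) - spent w ξ' .right y (n₀ + 1) := by
    refine hR.2 ?_
    rintro _ ⟨k, rfl⟩
    obtain ⟨n, hn⟩ := hcr' (crossings w ξ .right y (k₀ + 1 + k))
    have hn₀ : n₀ + 1 ≤ n := by
      by_contra! hlt
      have h1 := crossings_mono w ξ' .right y (show n ≤ n₀ by omega)
      have h2 := crossings_mono w ξ .right y (Nat.le_add_right (k₀ + 1) k)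
      omega
    obtain ⟨b, rfl⟩ := Nat.exists_eq_add_of_le hn₀
    have h1 := spent_add_le_spent_add (k₀ := k₀ + 1) (n₀ := n₀ + 1) hw hmono (hξ .right y) (hle y)
      (hc1.trans hc1'.symm) k b (fun i _ j _ => hI _ i j) hn.symm
    have h2 := spent_mono hw (hξ .right y) (show k ≤ k₀ + 1 + k by omega)
    have h3 := hR'.1 ⟨n₀ + 1 + b, rfl⟩
    linarith
  linarith

end Rubin

end

noncomputable section

namespace Rubin

variable {w : ℕ → ℝ}

/-! ### Measurability -/

/-- A measurable family indexed by a countable discrete space may be evaluated at a measurable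
random index. -/
lemma measurable_comp_index {Ω ι γ : Type*} [MeasurableSpace Ω] [MeasurableSpace γ]
    [MeasurableSpace ι] [Countable ι] [MeasurableSingletonClass ι] {F : ι → Ω → γ} {i : Ω → ι}
    (hF : ∀ j, Measurable (F j)) (hi : Measurable i) : Measurable fun ω => F (i ω) ω :=
  (measurable_from_prod_countable_right (f := fun p : ι × Ω => F p.1 p.2) hF).comp
    (hi.prodMk measurable_id)

/-- Measurability of all the components of a random configuration except its time. -/
structure MeasurableState {Ω : Type*} [MeasurableSpace Ω] (s : Ω → RubinState) : Prop where
  pos : Measurable fun ω => (s ω).pos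
  visits : ∀ z, Measurable fun ω => (s ω).visits z
  crossings : ∀ d z, Measurable fun ω => (s ω).crossings d z
  clock : ∀ d z, Measurable fun ω => (s ω).clock d z

variable {Ω : Type*} [MeasurableSpace Ω] {ξ : Side → ℤ → ℕ → Ω → ℝ} {s t : Ω → RubinState}

lemma MeasurableState.ite (hs : MeasurableState s) (ht : MeasurableState t) {p : Ω → Prop}
    [DecidablePred p] (hp : MeasurableSet {ω | p ω}) :
    MeasurableState fun ω => if p ω then s ω else t ω where
  pos := by
    simp only [apply_ite RubinState.pos]
    exact hs.pos.ite hp ht.pos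
  visits z := by
    simp only [apply_ite RubinState.visits, ite_apply]
    exact (hs.visits z).ite hp (ht.visits z)
  crossings d z := by
    simp only [apply_ite RubinState.crossings, ite_apply]
    exact (hs.crossings d z).ite hp (ht.crossings d z)
  clock d z := by
    simp only [apply_ite RubinState.clock, ite_apply]
    exact (hs.clock d z).ite hp (ht.clock d z)

lemma MeasurableState.jump (hξ : ∀ d y k, Measurable (ξ d y k)) (hs : MeasurableState s)
    (d : Side) :
    MeasurableState fun ω => Rubin.jump w (fun e x k => ξ e x k ω) (s ω) d where
  pos := hs.pos.add_const d.sgn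
  visits z := by
    refine Measurable.ite ?_ ((hs.visits z).add_const 1) (hs.visits z)
    exact measurableSet_eq_fun measurable_const (hs.pos.add_const d.sgn)
  crossings e z := by
    refine Measurable.ite ?_ ((hs.crossings e z).add_const 1) (hs.crossings e z)
    exact (MeasurableSet.const _).inter (measurableSet_eq_fun measurable_const hs.pos)
  clock e z := by
    have hy := hs.pos.add_const d.sgn
    have hx : Measurable fun ω => w ((s ω).visits (s ω).pos) :=
      (measurable_of_countable w).comp (measurable_comp_index hs.visits hs.pos)
    refine Measurable.ite (measurableSet_eq_fun measurable_const hy) ?_ ?_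
    · refine Measurable.ite (MeasurableSet.const _) ?_ (Measurable.ite ?_ ?_ ?_)
      · refine Measurable.div ?_ hx
        exact measurable_comp_index (F := fun (y : ℤ) ω => ξ e y ((s ω).crossings e y) ω)
          (fun y => measurable_comp_index (hξ e y) (hs.crossings e y)) hy
      · exact (measurableSet_eq_fun hy measurable_const).union
          (measurableSet_lt measurable_const (measurable_comp_index hs.visits hy))
      · exact measurable_comp_index (hs.clock e) hy
      · exact (measurable_comp_index (fun y => hξ e y 0) hy).div_const _
    · refine Measurable.ite (measurableSet_eq_fun measurable_const hs.pos) ?_ (hs.clock e z)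
      exact (measurable_comp_index (hs.clock e) hs.pos).sub
        (measurable_comp_index (hs.clock d) hs.pos)

lemma measurableState_state (hξ : ∀ d y k, Measurable (ξ d y k)) (k : ℕ) :
    MeasurableState fun ω => state w (fun e x k => ξ e x k ω) k := by
  induction k with
  | zero =>
    refine ⟨measurable_const, fun _ => measurable_const, fun _ _ => measurable_const,
      fun d z => ?_⟩
    exact Measurable.ite (MeasurableSet.const _) ((hξ d 0 0).div_const _) measurable_const
  | succ k ih =>
    have hc : ∀ d, Measurable fun ω => (state w (fun e x k => ξ e x k ω) k).clock d
        (state w (fun e x k => ξ e x k ω) k).pos := fun d =>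
      measurable_comp_index (ih.clock d) ih.pos
    exact (ih.jump hξ .left).ite ((ih.jump hξ .right).ite ih
      (measurableSet_lt (hc .right) (hc .left))) (measurableSet_lt (hc .left) (hc .right))

lemma measurableSet_totalVisits_eq_top (hξ : ∀ d y k, Measurable (ξ d y k)) (y : ℤ) :
    MeasurableSet {ω | totalVisits w (fun e x k => ξ e x k ω) y = ⊤} := by
  simp only [totalVisits, ENat.iSup_natCast_eq_top, not_bddAbove_iff, Set.exists_range_iff,
    Set.ofPred_forall, Set.ofPred_exists]
  exact MeasurableSet.iInter fun n => MeasurableSet.iUnion fun k =>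
    measurableSet_lt measurable_const ((measurableState_state hξ k).visits y)

lemma measurable_totalClock (hξ : ∀ d y k, Measurable (ξ d y k)) (d : Side) (y : ℤ) :
    Measurable fun ω => totalClock w (fun e x k => ξ e x k ω) d y := by
  refine Measurable.tsum fun k => ?_
  have hk := measurableState_state (w := w) hξ k
  have hk' := measurableState_state (w := w) hξ (k + 1)
  refine Measurable.ite ?_ (ENNReal.measurable_ofReal.comp (Measurable.div ?_ ?_)) measurable_const
  · exact (measurableSet_eq_fun hk.pos measurable_const).inter
      (measurableSet_eq_fun hk'.pos measurable_const)
  · exact measurable_comp_index (hξ d y) (hk.crossings d y)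
  · exact (measurable_of_countable w).comp (hk.visits _)

lemma measurableSet_balancedAt (hξ : ∀ d y k, Measurable (ξ d y k)) (y : ℤ) :
    MeasurableSet {ω | BalancedAt w (fun e x k => ξ e x k ω) y} :=
  (measurableSet_eq_fun (measurable_totalClock hξ _ y) (measurable_totalClock hξ _ y)).inter
    ((measurableSet_lt (measurable_totalClock hξ _ y) measurable_const).inter
      ((measurableSet_totalVisits_eq_top hξ _).inter (measurableSet_totalVisits_eq_top hξ _)))

/-! ### Product measures -/

/-- Resampling one coordinate preserves a product of probability measures. -/
lemma map_update_infinitePi {ι : Type*} [DecidableEq ι] {X : ι → Type*}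
    [∀ i, MeasurableSpace (X i)]
    (μ : ∀ i, Measure (X i)) [∀ i, IsProbabilityMeasure (μ i)] (i : ι) :
    ((Measure.infinitePi μ).prod (μ i)).map (fun p => Function.update p.1 i p.2) =
      Measure.infinitePi μ := by
  refine Measure.eq_infinitePi μ fun s t ht => ?_
  have hm : Measurable fun p : (∀ j, X j) × X i => Function.update p.1 i p.2 :=
    measurable_update'
  rw [Measure.map_apply hm (MeasurableSet.pi s.countable_toSet fun j _ => ht j)]
  by_cases hi : i ∈ s
  · have : (fun p : (∀ j, X j) × X i => Function.update p.1 i p.2) ⁻¹' Set.pi s t =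
        Set.pi (s.erase i) t ×ˢ t i := by
      ext p
      simp only [Set.mem_preimage, Set.mem_prod]
      rw [← Finset.insert_erase hi, Finset.coe_insert, Set.insert_pi]
      simp only [Set.mem_inter_iff, Set.mem_preimage, Function.eval, Function.update_self,
        Finset.erase_insert (Finset.notMem_erase i s)]
      rw [and_comm]
      refine and_congr_left fun _ => ?_
      simp only [Set.mem_pi]
      refine forall₂_congr fun j hj => ?_
      rw [Function.update_of_ne (by rintro rfl; simp at hj)]
    rw [this, Measure.prod_prod, Measure.infinitePi_pi _ (fun j _ => ht j),
      Finset.prod_erase_mul _ _ hi]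
  · have : (fun p : (∀ j, X j) × X i => Function.update p.1 i p.2) ⁻¹' Set.pi s t =
        Set.pi s t ×ˢ Set.univ := by
      ext p
      simp only [Set.mem_preimage, Set.mem_prod, Set.mem_univ, and_true, Set.mem_pi]
      refine forall₂_congr fun j hj => ?_
      rw [Function.update_of_ne (by rintro rfl; exact hi hj)]
    rw [this, Measure.prod_prod, Measure.infinitePi_pi _ (fun j _ => ht j), measure_univ, mul_one]

/-- A measurable set is null for a product measure if it contains at most one point of each line
in the direction of a coordinate whose law has no atoms. -/
lemma infinitePi_eq_zero_of_subsingleton {ι : Type*} [DecidableEq ι] {X : ι → Type*}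
    [∀ i, MeasurableSpace (X i)] (μ : ∀ i, Measure (X i)) [∀ i, IsProbabilityMeasure (μ i)]
    (i : ι) [NullSingletonClass (μ i)] {B : Set (∀ i, X i)} (hB : MeasurableSet B)
    (h : ∀ x, {t | Function.update x i t ∈ B}.Subsingleton) : Measure.infinitePi μ B = 0 := by
  have hm : Measurable fun p : (∀ j, X j) × X i => Function.update p.1 i p.2 :=
    measurable_update'
  rw [← map_update_infinitePi μ i, Measure.map_apply hm hB, Measure.measure_prod_null (hm hB)]
  exact Filter.Eventually.of_forall fun x => (h x).measure_zero _

instance nullSingletonClass_expMeasure (r : ℝ) : NullSingletonClass (expMeasure r) := by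
  unfold expMeasure gammaMeasure
  exact nullSingletonClass_withDensity _

lemma expMeasure_Iio_zero (r : ℝ) : expMeasure r (Set.Iio 0) = 0 := by
  rw [expMeasure, gammaMeasure, withDensity_apply _ measurableSet_Iio]
  exact lintegral_gammaPDF_of_nonpos le_rfl

/-! ### The balanced event is null -/

theorem measure_balancedAt_eq_zero (P : Measure Ω) [IsProbabilityMeasure P]
    {f : Side → ℤ → ℕ → ℝ} (hf : ∀ d x k, 0 < f d x k) (hw : ∀ n, 0 < w n) (hmono : Monotone w)
    (hξ : IsExpClocks P f ξ) (y : ℤ) :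
    P {ω | BalancedAt w (fun d x k => ξ d x k ω) y} = 0 := by
  obtain ⟨hind, hlaw⟩ := hξ
  let μ : Side × ℤ × ℕ → Measure ℝ := fun i => expMeasure (1 / f i.1 i.2.1 i.2.2)
  have hμ : ∀ i, IsProbabilityMeasure (μ i) := fun i =>
    isProbabilityMeasure_expMeasure (one_div_pos.mpr (hf _ _ _))
  have hXm : AEMeasurable (fun ω (i : Side × ℤ × ℕ) => ξ i.1 i.2.1 i.2.2 ω) P :=
    aemeasurable_pi_iff.2 fun i => (hlaw _ _ _).aemeasurable
  have hX := (hind.hasLaw_infinitePi (μ := μ) (fun i => hlaw _ _ _) hXm).map_eq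
  have hneg : P {ω | ∃ i : Side × ℤ × ℕ, ξ i.1 i.2.1 i.2.2 ω < 0} = 0 := by
    rw [Set.ofPred_exists]
    refine measure_iUnion_null fun i => ?_
    rw [(hlaw i.1 i.2.1 i.2.2).measure_eq (p := fun t => t < 0) measurableSet_Iio]
    exact expMeasure_Iio_zero _
  let B : Set (Side × ℤ × ℕ → ℝ) :=
    {x | BalancedAt w (fun d z k => x (d, z, k)) y} ∩ {x | ∀ i, 0 ≤ x i}
  have hB : MeasurableSet B := by
    refine (measurableSet_balancedAt (ξ := fun d z k (x : Side × ℤ × ℕ → ℝ) => x (d, z, k))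
      (fun d z k => measurable_pi_apply _) y).inter ?_
    rw [Set.ofPred_forall]
    exact MeasurableSet.iInter fun i => measurableSet_le measurable_const (measurable_pi_apply i)
  have hB0 : Measure.infinitePi μ B = 0 := by
    classical
    have : NullSingletonClass (μ (.right, y, 0)) := nullSingletonClass_expMeasure _
    have key : ∀ (x : Side × ℤ × ℕ → ℝ) (t u : ℝ), t < u →
        Function.update x (.right, y, 0) t ∈ B → Function.update x (.right, y, 0) u ∉ B := by
      rintro x t u htu ⟨ht, ht0⟩ ⟨hu, hu0⟩
      refine not_balancedAt_of_lt hw hmono (fun e z m => ht0 (e, z, m))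
        (fun e z m => hu0 (e, z, m)) (fun e z m h => ?_) ?_ ht hu
      · rw [Function.update_of_ne h, Function.update_of_ne h]
      · simpa using htu
    refine infinitePi_eq_zero_of_subsingleton μ (.right, y, 0) hB fun x t ht u hu => ?_
    rcases lt_trichotomy t u with h | h | h
    · exact absurd hu (key x t u h ht)
    · exact h
    · exact absurd ht (key x u t h hu)
  rw [← hX, Measure.map_apply_of_aemeasurable hXm hB] at hB0
  refine measure_mono_null (fun ω hω => ?_) (measure_union_null hB0 hneg)
  by_cases h : ∃ i : Side × ℤ × ℕ, ξ i.1 i.2.1 i.2.2 ω < 0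
  · exact Or.inr h
  · exact Or.inl ⟨hω, fun i => not_lt.mp fun hi => h ⟨i, hi⟩⟩

end Rubin
end

theorem proposition4 {Ω : Type*} [MeasurableSpace Ω] (P : Measure Ω) [IsProbabilityMeasure P]
    (ξ : Side → ℤ → ℕ → Ω → ℝ) :
    -- the functions `f^±` and `w` of the self-interacting walk with parameters `α`, `β`
    (∀ α β : ℝ, 0 ≤ α → 0 < β → Rubin.IsExpClocks P (StuckWalk.f α β) ξ →
      ∀ y : ℤ, P {ω | Rubin.BalancedAt (StuckWalk.w α β) (fun d x k => ξ d x k ω) y} = 0) ∧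
    -- arbitrary positive `f^±` and arbitrary positive non-decreasing `w`
    (∀ (f : Side → ℤ → ℕ → ℝ) (w : ℕ → ℝ), (∀ d x k, 0 < f d x k) → (∀ n, 0 < w n) →
      Monotone w → Rubin.IsExpClocks P f ξ →
      ∀ y : ℤ, P {ω | Rubin.BalancedAt w (fun d x k => ξ d x k ω) y} = 0) := by
  refine ⟨fun α β hα hβ hξ y => ?_, fun f w hf hw hmono hξ y =>
    Rubin.measure_balancedAt_eq_zero P hf hw hmono hξ y⟩
  refine Rubin.measure_balancedAt_eq_zero P (fun d x k => Real.exp_pos _) (fun n => Real.exp_pos _)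
    (fun m n hmn => Real.exp_le_exp.mpr ?_) hξ y
  have : (m : ℝ) ≤ n := by exact_mod_cast hmn
  gcongr
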